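/- **Theorem 5.2 (Non-differentiability on a dense subset).** Let $d\ge 2$, $\mathbb I=[0,1]$, and let $\lambda_{d-1}$ be Lebesgue measure on $\mathbb I^{d-1}$. A $d$-dimensional copula is the restriction to $\mathbb I^d$ of the joint distribution function of a random vector whose components are uniformly distributed on $\mathbb I$. It is Archimedean if $C(\mathbf x)=\psi\big(\sum_{i=1}^d\varphi(x_i)\big)$ on $\mathbb I^d$ for a generator $\psi$, i.e. a continuous, non-increasing $\psi:[0,\infty)\to\mathbb I$ with $\psi(0)=1$, $\lim_{z\to\infty}\psi(z)=0=:\psi(\infty)$ that is strictly decreasing on $[0,\inf\{x:\psi(x)=0\})$ (with $\inf\emptyset=\infty$), where $\varphi(y)=\inf\{z\in[0,\infty]:\psi(z)=y\}$. There exist a $d$-dimensional Archimedean copula $C$ and a Borel set $\Lambda\subseteq\mathbb I^{d-1}$ with $\lambda_{d-1}(\Lambda)=1$ such that for every $\mathbf x\in\Lambda$ the set of all $y\in\mathbb I$ for which the mixed partial derivative $\partial_1\partial_2\cdots\partial_{d-1}C(\mathbf x,y)$ does not exist is dense in $\mathbb I$. For the same $C$ and $\Lambda$, and for every $\mathbf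 x\in\Lambda$ and every permutation $\sigma$ of $\{1,\dots,d-1\}$, the set of all $y\in\mathbb I$ for which $\partial_{\sigma(1)}\cdots\partial_{\sigma(d-1)}C(\mathbf x,y)$ does not exist is dense in $\mathbb I$. Here $\partial_{i_1}\cdots\partial_{i_k}C$ exists at a point if $\partial_{i_2}\cdots\partial_{i_k}C$ exists at all points obtained from it by a sufficiently small change of the $i_1$-th coordinate within $\mathbb I$ and is differentiable there, as a function of that coordinate, at the point (one-sidedly if the coordinate is $0$ or $1$). Moreover, $C$ can be chosen with the generator $$\psi(z)=\int_{[0,\infty)}\big(\max\{1-tz,0\}\big)^{d-1}\,\mathrm d\gamma(t),\qquad z\in[0,\infty),$$ for a probability measure $\gamma$ on $[0,\infty)$ that is discrete (concentrated on a countable set), has $\gamma(\{0\})=0$ and $\int_{[0,1]}(1-t)^{d-1}\,\mathrm d\gamma(t)=\tfrac12$, and whose set of atoms is dense in $[0,\infty)$. -/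

import Mathlib

open MeasureTheory Set Filter Topology
open scoped NNReal ENNReal

namespace ArchCop

/-- `C` is (on the cube `[0,1]^d`) a `d`-dimensional copula: the restriction to `[0,1]^d` of the
joint distribution function of a probability law `μ` on `ℝ^d` all of whose one-dimensional
marginals are uniform on `[0,1]`. Values of `C` outside the cube play no role. -/
def IsCopula {d : ℕ} (C : (Fin d → ℝ) → ℝ) : Prop :=
  ∃ μ : Measure (Fin d → ℝ), IsProbabilityMeasure μ ∧
    (∀ i, μ.map (fun z => z i) = (volume : Measure ℝ).restrict (Icc 0 1)) ∧
    ∀ x ∈ Icc (0 : Fin d → ℝ) 1, C x = μ.real (Iic x)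

/-- Archimedean generators `ψ : [0,∞) → [0,1]`. The infimum is taken in `[0,∞]`, so that it is `∞`
if `ψ` has no zero. -/
structure IsGenerator (ψ : ℝ≥0 → ℝ) : Prop where
  mem_Icc : ∀ z, ψ z ∈ Icc (0 : ℝ) 1
  antitone : Antitone ψ
  continuous : Continuous ψ
  map_zero : ψ 0 = 1
  tendsto_zero : Tendsto ψ atTop (𝓝 0)
  strictAntiOn :
    StrictAntiOn ψ {z : ℝ≥0 | (z : ℝ≥0∞) < sInf ((fun x : ℝ≥0 => (x : ℝ≥0∞)) '' {x | ψ x = 0})}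

open Classical in
/-- The extension of `ψ` to `[0,∞]` by `ψ(∞) = 0`. -/
noncomputable def extend (ψ : ℝ≥0 → ℝ) (z : ℝ≥0∞) : ℝ :=
  if z = ∞ then 0 else ψ z.toNNReal

/-- The pseudo-inverse `φ(y) = inf {z ∈ [0,∞] | ψ(z) = y}`, with values in `[0,∞]`. -/
noncomputable def pseudoInv (ψ : ℝ≥0 → ℝ) (y : ℝ) : ℝ≥0∞ :=
  sInf {z : ℝ≥0∞ | extend ψ z = y}

/-- The function `C_ψ(x) = ψ(φ(x₁) + ⋯ + φ(x_d))`. -/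
noncomputable def archFun (ψ : ℝ≥0 → ℝ) {d : ℕ} (x : Fin d → ℝ) : ℝ :=
  extend ψ (∑ i, pseudoInv ψ (x i))

/-- `C` is a `d`-dimensional Archimedean copula. -/
def IsArchimedeanCopula {d : ℕ} (C : (Fin d → ℝ) → ℝ) : Prop :=
  IsCopula C ∧ ∃ ψ : ℝ≥0 → ℝ, IsGenerator ψ ∧ ∀ x ∈ Icc (0 : Fin d → ℝ) 1, C x = archFun ψ x

/-- Normalized `d`-Williamson measures: probability measures on `[0,∞)` without mass at `0` and
with `∫_{[0,1]} (1 - t)^(d-1) dγ(t) = 1/2`. -/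
structure IsWilliamsonMeasure (d : ℕ) (γ : Measure ℝ≥0) : Prop where
  isProbabilityMeasure : IsProbabilityMeasure γ
  no_mass_zero : γ {0} = 0
  normalized : ∫ t in Iic (1 : ℝ≥0), (1 - (t : ℝ)) ^ (d - 1) ∂γ = 1 / 2

/-- The Williamson `d`-transform `ψ(z) = ∫ (1 - t z)₊^(d-1) dγ(t)`. -/
noncomputable def williamson (d : ℕ) (γ : Measure ℝ≥0) (z : ℝ≥0) : ℝ :=
  ∫ t : ℝ≥0, (max (1 - (t : ℝ) * (z : ℝ)) 0) ^ (d - 1) ∂γ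

/-- A measure that is concentrated on a countable set. -/
def IsDiscrete (γ : Measure ℝ≥0) : Prop :=
  ∃ S : Set ℝ≥0, S.Countable ∧ γ Sᶜ = 0

/-- `HasMixedPartial C [i₁, …, i_k] p v`: the iterated partial derivative `∂_{i₁} ⋯ ∂_{i_k} C`
of `C : [0,1]^d → ℝ` exists at the point `p` of the cube and equals `v`. The rightmost partial
derivative is taken first. Thus `∂_{i₂} ⋯ ∂_{i_k} C` has to exist at all points that are obtained
from `p` by a small change of its coordinate `i₁` within `[0,1]`, and has to be differentiable in
that coordinate at `p`. (At a coordinate `0` or `1` of `p` the derivative is one-sided.) -/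
def HasMixedPartial {d : ℕ} (C : (Fin d → ℝ) → ℝ) : List (Fin d) → (Fin d → ℝ) → ℝ → Prop
  | [], p, v => C p = v
  | i :: l, p, v => ∃ g : ℝ → ℝ,
      (∀ᶠ t in 𝓝[Icc 0 1] (p i), HasMixedPartial C l (Function.update p i t) (g t)) ∧
      HasDerivWithinAt g v (Icc 0 1) (p i)

/-- The iterated partial derivative `∂_{i₁} ⋯ ∂_{i_k} C` exists (as a real number) at `p`. -/
def MixedPartialExists {d : ℕ} (C : (Fin d → ℝ) → ℝ) (l : List (Fin d)) (p : Fin d → ℝ) : Prop :=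
  ∃ v : ℝ, HasMixedPartial C l p v

/-- The point `(x, y)` of `ℝ^(n+1)` for `x` in `ℝ^n` and `y` in `ℝ`. -/
def point {n : ℕ} (x : Fin n → ℝ) (y : ℝ) : Fin (n + 1) → ℝ :=
  Fin.snoc (α := fun _ => ℝ) x y

/-- The first `n` of the `n + 1` coordinates, in the order `σ(1), …, σ(n)`. -/
def ordering {n : ℕ} (σ : Equiv.Perm (Fin n)) : List (Fin (n + 1)) :=
  List.ofFn fun k => (σ k).castSucc

end ArchCop

namespace ArchCop

/-! ### Truncated moments -/

/-! Write `n = d - 1`, `ψ(z) = ∫ (1 - tz)₊^n dγ(t)` and `φ = ψ⁻¹`. Differentiating `ψ` under the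
integral `n - 1` times gives a nonzero multiple of `z ↦ ∫ t^(n-1) (1 - tz)₊ dγ(t)`. This function
has a kink at `z` when `1/z` is an atom of `γ` (`not_differentiableAt_truncMoment`).

By the chain rule, the first `n - 1` partial derivatives of `C` at `p` give `ψ^(n-1)(∑ φ(pⱼ))` times
nonzero factors `φ'(pⱼ)`. If the last one existed, composing with `ψ` would remove the inner `φ`,
and `ψ^(n-1)` would be differentiable at `∑ φ(pⱼ)`. This is impossible if `1 / ∑ φ(pⱼ)` is an atom
(`not_mixedPartialExists_of_atom`). For fixed `x`, density of the atoms makes such `y` dense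
(`Icc_subset_closure_of_atoms`). The composition needs `ψ` differentiable at `φ(xᵢ)`, which for `n =
1` excludes countably many values of `xᵢ`; hence `Λ` is a cube with a null set removed.

That `C` is a copula comes from a random vector: for `S` uniform on the unit simplex and an
independent `T ∼ γ`, the vector `ψ(Sᵢ/T)` has distribution function `C` on the cube (`archLaw_Iic`).
-/

theorem hasDerivAt_max_zero_pow {m : ℕ} {u : ℝ} (h : 2 ≤ m ∨ u ≠ 0) (hm : 1 ≤ m) :
    HasDerivAt (fun u : ℝ => max u 0 ^ m) (if 0 < u then m * u ^ (m - 1) else 0) u := by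
  rcases lt_trichotomy u 0 with hu | rfl | hu
  · rw [if_neg hu.not_gt]
    refine (hasDerivAt_const u (0 : ℝ)).congr_of_eventuallyEq ?_
    filter_upwards [eventually_lt_nhds hu] with x hx
    rw [max_eq_right hx.le, zero_pow (by omega)]
  · rw [if_neg (lt_irrefl _)]
    have h2 : 1 < m := by
      rcases h with h | h
      · omega
      · exact absurd rfl h
    rw [hasDerivAt_iff_isLittleO]
    have h0 : max (0 : ℝ) 0 ^ m = 0 := by rw [max_self, zero_pow (by omega)]
    simp only [sub_zero, smul_zero, h0]
    have hO : (fun x : ℝ => max x 0) =O[𝓝 0] fun x => x :=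
      Asymptotics.isBigO_of_le _ fun x => by
        rw [Real.norm_eq_abs, Real.norm_eq_abs, abs_of_nonneg (le_max_right _ _)]
        exact max_le (le_abs_self x) (abs_nonneg x)
    exact (hO.pow m).trans_isLittleO (Asymptotics.isLittleO_pow_id h2)
  · rw [if_pos hu]
    refine (hasDerivAt_pow m u).congr_of_eventuallyEq ?_
    filter_upwards [eventually_gt_nhds hu] with x hx
    rw [max_eq_left hx.le]

theorem abs_max_zero_pow_sub_le {a b : ℝ} (m : ℕ) (ha : a ≤ 1) (hb : b ≤ 1) :
    |max a 0 ^ m - max b 0 ^ m| ≤ |a - b| * m := by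
  refine (abs_pow_sub_pow_le _ _ m).trans ?_
  have h1 : |max a 0 - max b 0| ≤ |a - b| := abs_max_sub_max_le_abs a b 0
  have h2 : max |max a 0| |max b 0| ≤ 1 := by
    rw [abs_of_nonneg (le_max_right a 0), abs_of_nonneg (le_max_right b 0)]
    simp [ha, hb]
  have h3 : max |max a 0| |max b 0| ^ (m - 1) ≤ 1 :=
    pow_le_one₀ (le_max_of_le_left (abs_nonneg _)) h2
  calc _ ≤ |max a 0 - max b 0| * m * 1 := by gcongr
    _ ≤ |a - b| * m := by rw [mul_one]; gcongr

/-- The integral `∫ t^j (1 - t z)₊^m dγ(t)`. -/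
noncomputable def truncMoment (γ : Measure ℝ≥0) (j m : ℕ) (z : ℝ) : ℝ :=
  ∫ t : ℝ≥0, (t : ℝ) ^ j * max (1 - (t : ℝ) * z) 0 ^ m ∂γ

/-- The integrand vanishes unless `t < 1/z ≤ 1/a`. Thus no moment condition on `γ` is needed, only
`z` bounded away from `0`. -/
theorem truncMoment_integrand_le {j m : ℕ} (hm : 1 ≤ m) {a z : ℝ} (ha : 0 < a) (hz : a ≤ z)
    (t : ℝ≥0) : (t : ℝ) ^ j * max (1 - (t : ℝ) * z) 0 ^ m ≤ a⁻¹ ^ j := by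
  have ht : (0 : ℝ) ≤ t := t.2
  by_cases h : (t : ℝ) * z < 1
  · have h1 : max (1 - (t : ℝ) * z) 0 ^ m ≤ 1 := by
      apply pow_le_one₀ (le_max_right _ _)
      exact max_le (by nlinarith [mul_nonneg ht (ha.le.trans hz)]) zero_le_one
    have h2 : (t : ℝ) ≤ a⁻¹ := by
      rw [← one_div, le_div_iff₀ ha]
      nlinarith
    calc (t : ℝ) ^ j * max (1 - (t : ℝ) * z) 0 ^ m ≤ a⁻¹ ^ j * 1 := by gcongr
      _ = _ := mul_one _
  · rw [max_eq_right (by linarith), zero_pow (by omega), mul_zero]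
    positivity

theorem continuous_truncMoment_integrand (j m : ℕ) (z : ℝ) :
    Continuous fun t : ℝ≥0 => (t : ℝ) ^ j * max (1 - (t : ℝ) * z) 0 ^ m := by
  fun_prop

theorem truncMoment_integrand_nonneg (j m : ℕ) (z : ℝ) (t : ℝ≥0) :
    0 ≤ (t : ℝ) ^ j * max (1 - (t : ℝ) * z) 0 ^ m := by
  have : 0 ≤ max (1 - (t : ℝ) * z) 0 := le_max_right _ _
  positivity

section

variable {γ : Measure ℝ≥0} [IsFiniteMeasure γ] {j m : ℕ} {z : ℝ}

theorem integrable_truncMoment (hm : 1 ≤ m) (hz : 0 < z) :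
    Integrable (fun t : ℝ≥0 => (t : ℝ) ^ j * max (1 - (t : ℝ) * z) 0 ^ m) γ := by
  refine Integrable.of_bound (continuous_truncMoment_integrand j m z).aestronglyMeasurable
    (z⁻¹ ^ j) (ae_of_all _ fun t => ?_)
  rw [Real.norm_of_nonneg (truncMoment_integrand_nonneg j m z t)]
  exact truncMoment_integrand_le hm hz le_rfl t

/-- The constant must not depend on `t`. For `t ≤ 2/z` the slope is at most `m t^(j+1)`; for larger
`t` the integrand is zero throughout `x > z/2`. -/
theorem lipschitzOnWith_truncMoment_integrand (hm : 1 ≤ m) (hz : 0 < z) (t : ℝ≥0) :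
    LipschitzOnWith (Real.nnabs (m * (2 / z) ^ (j + 1)))
      (fun x : ℝ => (t : ℝ) ^ j * max (1 - (t : ℝ) * x) 0 ^ m) (Ioi (z / 2)) := by
  refine LipschitzOnWith.of_dist_le_mul fun x hx y hy => ?_
  have hx : z / 2 < x := hx
  have hy : z / 2 < y := hy
  have ht : (0 : ℝ) ≤ t := t.2
  rw [Real.dist_eq, Real.dist_eq, Real.coe_nnabs,
    abs_of_nonneg (show 0 ≤ (m : ℝ) * (2 / z) ^ (j + 1) by positivity), ← mul_sub,
    abs_mul, abs_of_nonneg (by positivity : (0 : ℝ) ≤ (t : ℝ) ^ j)]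
  by_cases h : (t : ℝ) ≤ 2 / z
  · have h1 := abs_max_zero_pow_sub_le m (a := 1 - (t : ℝ) * x) (b := 1 - (t : ℝ) * y)
      (by nlinarith) (by nlinarith)
    have h2 : |1 - (t : ℝ) * x - (1 - (t : ℝ) * y)| = t * |x - y| := by
      rw [show 1 - (t : ℝ) * x - (1 - (t : ℝ) * y) = -(t * (x - y)) by ring, abs_neg, abs_mul,
        abs_of_nonneg ht]
    rw [h2] at h1
    calc _ ≤ (t : ℝ) ^ j * (t * |x - y| * m) := by gcongr
      _ = m * (t : ℝ) ^ (j + 1) * |x - y| := by ring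
      _ ≤ _ := by gcongr
  · push Not at h
    rw [div_lt_iff₀ hz] at h
    rw [max_eq_right (by nlinarith), max_eq_right (by nlinarith), sub_self, abs_zero, mul_zero]
    positivity

/-- Domination by the uniform Lipschitz constant only requires differentiability of the integrand
for almost every `t`. For `m = 1` this fails only at `t = 1/z`, which the hypothesis makes null. -/
theorem hasDerivAt_truncMoment_ite (hm : 1 ≤ m) (hz : 0 < z)
    (h : 2 ≤ m ∨ ∀ᵐ t : ℝ≥0 ∂γ, (t : ℝ) * z ≠ 1) :
    HasDerivAt (truncMoment γ j m)
      (∫ t : ℝ≥0, (t : ℝ) ^ j *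
        ((if 0 < 1 - (t : ℝ) * z then m * (1 - (t : ℝ) * z) ^ (m - 1) else 0) * -(t : ℝ)) ∂γ) z := by
  refine (hasDerivAt_integral_of_dominated_loc_of_lip (s := Ioi (z / 2))
    (bound := fun _ => m * (2 / z) ^ (j + 1)) (Ioi_mem_nhds (by linarith)) (Eventually.of_forall
    fun x => (continuous_truncMoment_integrand j m x).aestronglyMeasurable)
    (integrable_truncMoment hm hz) ?_ (ae_of_all _ fun t =>
    lipschitzOnWith_truncMoment_integrand hm hz t) (integrable_const _) ?_).2
  · refine Measurable.aestronglyMeasurable ?_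
    refine Measurable.mul (by fun_prop) (Measurable.mul (Measurable.ite ?_ (by fun_prop)
      (by fun_prop)) (by fun_prop))
    exact measurableSet_lt (by fun_prop) (by fun_prop)
  · have : ∀ᵐ t : ℝ≥0 ∂γ, 2 ≤ m ∨ 1 - (t : ℝ) * z ≠ 0 := by
      rcases h with h | h
      · exact ae_of_all _ fun _ => Or.inl h
      · filter_upwards [h] with t ht
        exact Or.inr fun h0 => ht (by linarith)
    filter_upwards [this] with t ht
    have h1 : HasDerivAt (fun x : ℝ => 1 - (t : ℝ) * x) (-(t : ℝ)) z := by
      simpa using ((hasDerivAt_id z).const_mul (t : ℝ)).const_sub 1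
    exact ((hasDerivAt_max_zero_pow ht hm).comp z h1).const_mul _

theorem differentiableAt_truncMoment (hm : 1 ≤ m) (hz : 0 < z)
    (h : 2 ≤ m ∨ ∀ᵐ t : ℝ≥0 ∂γ, (t : ℝ) * z ≠ 1) : DifferentiableAt ℝ (truncMoment γ j m) z :=
  (hasDerivAt_truncMoment_ite hm hz h).differentiableAt

theorem hasDerivAt_truncMoment (hm : 1 ≤ m) (hz : 0 < z) :
    HasDerivAt (truncMoment γ j (m + 1)) (-(m + 1) * truncMoment γ (j + 1) m z) z := by
  refine (hasDerivAt_truncMoment_ite (by omega) hz (Or.inl (by omega))).congr_deriv ?_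
  rw [truncMoment, ← integral_const_mul]
  congr 1 with t
  split_ifs with h
  · rw [max_eq_left h.le]
    push_cast [Nat.add_sub_cancel]
    ring
  · rw [max_eq_right (by linarith), zero_pow (by omega)]
    ring

theorem not_differentiableAt_max_zero {t z : ℝ} (ht : t ≠ 0) (htz : t * z = 1) :
    ¬ DifferentiableAt ℝ (fun x : ℝ => max (1 - t * x) 0) z := by
  intro h
  -- An affine change of variable moves the kink to `0`, where `2 max(x, 0) - x = |x|`.
  have h1 : DifferentiableAt ℝ (fun x : ℝ => 2 * max (1 - t * ((1 - x) / t)) 0 - x) 0 := by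
    refine ((DifferentiableAt.comp (g := fun x : ℝ => max (1 - t * x) 0)
      (f := fun x : ℝ => (1 - x) / t) 0 ?_ (by fun_prop)).const_mul 2).sub differentiableAt_id
    rwa [show (1 - (0 : ℝ)) / t = z by field_simp; linarith]
  refine not_differentiableAt_abs_zero (h1.congr_of_eventuallyEq (Eventually.of_forall fun x => ?_))
  have : 1 - t * ((1 - x) / t) = x := by field_simp; ring
  simp only [this]
  rcases le_total 0 x with hx | hx
  · rw [abs_of_nonneg hx, max_eq_left hx]; ring
  · rw [abs_of_nonpos hx, max_eq_right hx]; ring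

/-- Split off the atom `t₀ = 1/z`. The rest of `γ` contributes a function differentiable at `z`, so
the kink of the single term `t₀^j (1 - t₀ x)₊` survives. -/
theorem not_differentiableAt_truncMoment {t₀ : ℝ≥0} (h0 : γ {t₀} ≠ 0) (hz : 0 < z)
    (htz : (t₀ : ℝ) * z = 1) : ¬ DifferentiableAt ℝ (truncMoment γ j 1) z := by
  intro h
  have ht0 : (t₀ : ℝ) ≠ 0 := by rintro h; simp [h] at htz
  have h1 : DifferentiableAt ℝ (truncMoment (γ.restrict {t₀}ᶜ) j 1) z := by
    refine differentiableAt_truncMoment le_rfl hz (Or.inr ?_)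
    filter_upwards [ae_restrict_mem (measurableSet_singleton t₀).compl] with t ht h'
    refine ht (NNReal.coe_injective ?_)
    exact mul_right_cancel₀ hz.ne' (h'.trans htz.symm)
  have hc : γ.real {t₀} * (t₀ : ℝ) ^ j ≠ 0 :=
    mul_ne_zero (by simpa [measureReal_def, ENNReal.toReal_eq_zero_iff] using h0) (pow_ne_zero _ ht0)
  refine not_differentiableAt_max_zero ht0 htz
    (((h.sub h1).const_mul (γ.real {t₀} * (t₀ : ℝ) ^ j)⁻¹).congr_of_eventuallyEq ?_)
  filter_upwards [eventually_gt_nhds hz] with x hx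
  have h2 := integral_add_compl (μ := γ) (measurableSet_singleton t₀)
    (integrable_truncMoment (j := j) le_rfl hx)
  simp only [integral_singleton, pow_one, smul_eq_mul] at h2
  simp only [Pi.sub_apply, truncMoment, pow_one]
  rw [← h2, add_sub_cancel_right, ← mul_assoc, ← mul_assoc, mul_assoc _⁻¹, inv_mul_cancel₀ hc, one_mul]

theorem truncMoment_pos (hm : 1 ≤ m) (hz : 0 < z) {t₀ : ℝ≥0} (h0 : γ {t₀} ≠ 0) (ht₀ : 0 < t₀)
    (htz : (t₀ : ℝ) * z < 1) : 0 < truncMoment γ j m z := by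
  rw [truncMoment, integral_pos_iff_support_of_nonneg (truncMoment_integrand_nonneg j m z)
    (integrable_truncMoment hm hz)]
  refine (pos_iff_ne_zero.2 h0).trans_le (measure_mono ?_)
  intro x hx
  rw [mem_singleton_iff.1 hx]
  have h1 : 0 < max (1 - (t₀ : ℝ) * z) 0 := lt_max_of_lt_left (by linarith)
  have h2 : (0 : ℝ) < t₀ := ht₀
  exact (mul_pos (pow_pos h2 _) (pow_pos h1 _)).ne'

end

/-! ### The Williamson transform as a generator -/

theorem exists_atom_mem {γ : Measure ℝ≥0} (hd : Dense {t : ℝ≥0 | γ {t} ≠ 0}) {U : Set ℝ≥0}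
    (hU : IsOpen U) (hne : U.Nonempty) : ∃ t ∈ U, γ {t} ≠ 0 := by
  obtain ⟨t, h1, h2⟩ := hd.inter_open_nonempty U hU hne
  exact ⟨t, h1, h2⟩

/-- Atoms arbitrarily close to `0`. -/
theorem exists_small_atom {γ : Measure ℝ≥0} (hd : Dense {t : ℝ≥0 | γ {t} ≠ 0}) {z : ℝ}
    (hz : 0 < z) : ∃ t : ℝ≥0, γ {t} ≠ 0 ∧ 0 < t ∧ (t : ℝ) * z < 1 := by
  obtain ⟨t, ⟨h1, h2⟩, h3⟩ := exists_atom_mem hd (isOpen_Ioo (a := (0 : ℝ≥0))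
    (b := (Real.toNNReal z)⁻¹)) (nonempty_Ioo.2 (by simpa using hz))
  refine ⟨t, h3, h1, ?_⟩
  have h4 : (t : ℝ) < z⁻¹ := by
    have := NNReal.coe_lt_coe.2 h2
    rwa [NNReal.coe_inv, Real.coe_toNNReal z hz.le] at this
  rwa [← one_div, lt_div_iff₀ hz] at h4

theorem williamson_integrand_mem_Icc (n : ℕ) (t z : ℝ≥0) :
    max (1 - (t : ℝ) * z) 0 ^ n ∈ Icc (0 : ℝ) 1 := by
  refine ⟨by positivity, pow_le_one₀ (le_max_right _ _) (max_le ?_ zero_le_one)⟩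
  have : (0 : ℝ) ≤ t * z := by positivity
  linarith

section

variable {n : ℕ} {γ : Measure ℝ≥0}

theorem williamson_eq_truncMoment (z : ℝ≥0) :
    williamson (n + 1) γ z = truncMoment γ 0 n z := by
  simp [williamson, truncMoment]

theorem integrable_williamson [IsFiniteMeasure γ] (z : ℝ≥0) :
    Integrable (fun t : ℝ≥0 => max (1 - (t : ℝ) * z) 0 ^ n) γ := by
  refine Integrable.of_bound (by fun_prop) 1 (ae_of_all _ fun t => ?_)
  have := williamson_integrand_mem_Icc n t z
  rw [Real.norm_of_nonneg this.1]
  exact this.2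

theorem williamson_antitone [IsFiniteMeasure γ] : Antitone (williamson (n + 1) γ) := by
  intro z w hzw
  refine integral_mono (integrable_williamson w) (integrable_williamson z) fun t => ?_
  simp only [Nat.add_sub_cancel]
  gcongr

/-- An atom `t₀` with `0 < t₀ < 1/w` lies where the integrand is strictly decreasing up to `w`. As
such atoms exist for every `w`, `ψ` never reaches `0`. -/
theorem williamson_strictAnti [IsFiniteMeasure γ] (hn : 1 ≤ n)
    (hd : Dense {t : ℝ≥0 | γ {t} ≠ 0}) : StrictAnti (williamson (n + 1) γ) := by
  intro z w hzw
  have hw : (0 : ℝ) < w := (zero_le (a := z)).trans_lt hzw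
  have hzw' : (z : ℝ) < w := hzw
  obtain ⟨t₀, h0, hpos, h1⟩ := exists_small_atom hd hw
  have hpos' : (0 : ℝ) < t₀ := hpos
  rw [← sub_pos, williamson, williamson, Nat.add_sub_cancel,
    ← integral_sub' (integrable_williamson z) (integrable_williamson w),
    integral_pos_iff_support_of_nonneg _
      ((integrable_williamson z).sub (integrable_williamson w))]
  · refine (pos_iff_ne_zero.2 h0).trans_le (measure_mono ?_)
    intro x hx
    rw [mem_singleton_iff.1 hx]
    have h2 : (t₀ : ℝ) * z < t₀ * w := by gcongr
    refine (sub_pos.2 ?_).ne'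
    beta_reduce
    rw [max_eq_left (by linarith), max_eq_left (by linarith)]
    exact pow_lt_pow_left₀ (by linarith) (by linarith) (by omega)
  · intro t
    refine sub_nonneg.2 ?_
    beta_reduce
    gcongr

theorem continuous_williamson [IsFiniteMeasure γ] : Continuous (williamson (n + 1) γ) := by
  refine continuous_of_dominated (bound := fun _ => 1) (fun z => ?_) (fun z => ae_of_all _ fun t => ?_)
    (integrable_const _) (ae_of_all _ fun t => ?_)
  · exact (integrable_williamson z).aestronglyMeasurable
  · have := williamson_integrand_mem_Icc n t z
    rw [Nat.add_sub_cancel, Real.norm_of_nonneg this.1]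
    exact this.2
  · fun_prop

theorem williamson_mem_Icc [IsProbabilityMeasure γ] (z : ℝ≥0) :
    williamson (n + 1) γ z ∈ Icc (0 : ℝ) 1 := by
  refine ⟨integral_nonneg fun t => by positivity, ?_⟩
  calc williamson (n + 1) γ z ≤ ∫ _ : ℝ≥0, (1 : ℝ) ∂γ :=
        integral_mono (integrable_williamson z) (integrable_const _) fun t =>
          (williamson_integrand_mem_Icc n t z).2
    _ = 1 := by simp

theorem williamson_zero [IsProbabilityMeasure γ] : williamson (n + 1) γ 0 = 1 := by
  simp [williamson]

theorem tendsto_williamson [IsFiniteMeasure γ] (hn : 1 ≤ n) (h0 : γ {0} = 0) :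
    Tendsto (williamson (n + 1) γ) atTop (𝓝 0) := by
  rw [show (0 : ℝ) = ∫ _ : ℝ≥0, (0 : ℝ) ∂γ by simp]
  refine tendsto_integral_filter_of_dominated_convergence (fun _ => 1)
    (Eventually.of_forall fun z => (integrable_williamson z).aestronglyMeasurable)
    (Eventually.of_forall fun z => ae_of_all _ fun t => ?_) (integrable_const _) ?_
  · have := williamson_integrand_mem_Icc n t z
    rw [Nat.add_sub_cancel, Real.norm_of_nonneg this.1]
    exact this.2
  · have : ∀ᵐ t : ℝ≥0 ∂γ, t ≠ 0 := by
      rw [ae_iff]; simpa using h0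
    filter_upwards [this] with t ht
    refine tendsto_const_nhds.congr' ?_
    filter_upwards [eventually_ge_atTop t⁻¹] with z hz
    have h1 : (1 : ℝ) ≤ t * z := by
      have : 1 ≤ t * z := by
        rw [← mul_inv_cancel₀ ht]; gcongr
      exact_mod_cast this
    rw [max_eq_right (by linarith), Nat.add_sub_cancel, zero_pow (by omega)]

theorem isGenerator_williamson [IsProbabilityMeasure γ] (hn : 1 ≤ n) (h0 : γ {0} = 0)
    (hd : Dense {t : ℝ≥0 | γ {t} ≠ 0}) : IsGenerator (williamson (n + 1) γ) where
  mem_Icc := williamson_mem_Icc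
  antitone := williamson_antitone
  continuous := continuous_williamson
  map_zero := williamson_zero
  tendsto_zero := tendsto_williamson hn h0
  strictAntiOn := (williamson_strictAnti hn hd).strictAntiOn _

end

/-! ### Strictly decreasing generators -/

section

variable {ψ : ℝ≥0 → ℝ}

theorem extend_coe (z : ℝ≥0) : extend ψ z = ψ z := by simp [extend]

theorem IsGenerator.pos (h : IsGenerator ψ) (hs : StrictAnti ψ) (z : ℝ≥0) : 0 < ψ z :=
  (h.mem_Icc (z + 1)).1.trans_lt (hs (lt_add_of_pos_right z one_pos))

theorem IsGenerator.pseudoInv_apply (h : IsGenerator ψ) (hs : StrictAnti ψ) (z : ℝ≥0) :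
    pseudoInv ψ (ψ z) = z := by
  have : {w : ℝ≥0∞ | extend ψ w = ψ z} = {(z : ℝ≥0∞)} := by
    ext w
    simp only [mem_ofPred_eq, mem_singleton_iff]
    refine ⟨fun hw => ?_, fun hw => by rw [hw, extend_coe]⟩
    induction w with
    | top => simp only [extend, if_true] at hw; exact absurd hw (h.pos hs z).ne
    | coe w => rw [extend_coe] at hw; rw [hs.injective hw]
  rw [pseudoInv, this, sInf_singleton]

theorem IsGenerator.pseudoInv_zero (h : IsGenerator ψ) (hs : StrictAnti ψ) :
    pseudoInv ψ 0 = ∞ := by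
  rw [pseudoInv, sInf_eq_top]
  intro w hw
  induction w with
  | top => rfl
  | coe w => rw [mem_ofPred_eq, extend_coe] at hw; exact absurd hw (h.pos hs w).ne'

theorem IsGenerator.exists_eq (h : IsGenerator ψ) {y : ℝ} (hy : y ∈ Ioc (0 : ℝ) 1) :
    ∃ z, ψ z = y := by
  obtain ⟨w, hw⟩ := (h.tendsto_zero.eventually_lt_const hy.1).exists
  obtain ⟨z, -, hz⟩ := intermediate_value_Icc' (zero_le (a := w)) h.continuous.continuousOn
    (show y ∈ Icc (ψ w) (ψ 0) from ⟨hw.le, h.map_zero.symm ▸ hy.2⟩)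
  exact ⟨z, hz⟩

theorem archFun_apply (h : IsGenerator ψ) (hs : StrictAnti ψ) {d : ℕ} (z : Fin d → ℝ≥0) :
    archFun ψ (fun i => ψ (z i)) = ψ (∑ i, z i) := by
  simp only [archFun, h.pseudoInv_apply hs]
  rw [← ENNReal.ofNNReal_finsetSum, extend_coe]

theorem archFun_eq_zero (h : IsGenerator ψ) (hs : StrictAnti ψ) {d : ℕ} {x : Fin d → ℝ} {i : Fin d}
    (hi : x i = 0) : archFun ψ x = 0 := by
  have : ∑ i, pseudoInv ψ (x i) = ∞ := by
    rw [ENNReal.sum_eq_top]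
    exact ⟨i, Finset.mem_univ i, by rw [hi, h.pseudoInv_zero hs]⟩
  rw [archFun, this, extend, if_pos rfl]

end

/-! ### The inverse generator as a real function -/

/-- The pseudo-inverse of a generator as a real-valued function. -/
noncomputable def realInv (ψ : ℝ≥0 → ℝ) (y : ℝ) : ℝ := (pseudoInv ψ y).toReal

section

variable {ψ : ℝ≥0 → ℝ}

theorem IsGenerator.realInv_apply (h : IsGenerator ψ) (hs : StrictAnti ψ) (z : ℝ≥0) :
    realInv ψ (ψ z) = z := by
  rw [realInv, h.pseudoInv_apply hs, ENNReal.coe_toReal]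

theorem IsGenerator.exists_pos_eq (h : IsGenerator ψ) {y : ℝ} (hy : y ∈ Ioo (0 : ℝ) 1) :
    ∃ z, 0 < z ∧ ψ z = y := by
  obtain ⟨z, hz⟩ := h.exists_eq ⟨hy.1, hy.2.le⟩
  refine ⟨z, pos_iff_ne_zero.2 ?_, hz⟩
  rintro rfl
  rw [h.map_zero] at hz
  exact hy.2.ne hz.symm

theorem IsGenerator.apply_mem_Ioo (h : IsGenerator ψ) (hs : StrictAnti ψ) {z : ℝ≥0} (hz : 0 < z) :
    ψ z ∈ Ioo (0 : ℝ) 1 :=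
  ⟨h.pos hs z, h.map_zero ▸ hs hz⟩

theorem IsGenerator.realInv_pos (h : IsGenerator ψ) (hs : StrictAnti ψ) {y : ℝ}
    (hy : y ∈ Ioo (0 : ℝ) 1) : 0 < realInv ψ y := by
  obtain ⟨z, hz, rfl⟩ := h.exists_pos_eq hy
  rw [h.realInv_apply hs]
  exact hz

theorem IsGenerator.continuousAt_realInv (h : IsGenerator ψ) (hs : StrictAnti ψ) {y : ℝ}
    (hy : y ∈ Ioo (0 : ℝ) 1) : ContinuousAt (realInv ψ) y := by
  -- The sign turns the decreasing inverse into a monotone function; its image of `(0, 1)` contains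
  -- the whole negative half-line, so it cannot jump.
  have key : ContinuousAt (fun y => -realInv ψ y) y := by
    refine continuousAt_of_monotoneOn_of_image_mem_nhds (s := Ioo (0 : ℝ) 1) ?_
      (Ioo_mem_nhds hy.1 hy.2) ?_
    · intro a ha b hb hab
      obtain ⟨z, hz, rfl⟩ := h.exists_pos_eq ha
      obtain ⟨w, hw, rfl⟩ := h.exists_pos_eq hb
      simp only [h.realInv_apply hs]
      exact neg_le_neg (NNReal.coe_le_coe.2 (hs.le_iff_ge.1 hab))
    · refine mem_of_superset (Iio_mem_nhds (neg_lt_zero.2 (h.realInv_pos hs hy))) ?_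
      intro u hu
      have hu : 0 < -u := neg_pos.2 hu
      refine ⟨ψ (-u).toNNReal, h.apply_mem_Ioo hs (Real.toNNReal_pos.2 hu), ?_⟩
      simp only [h.realInv_apply hs, Real.coe_toNNReal _ hu.le, neg_neg]
  exact key.neg.congr (Eventually.of_forall fun x => neg_neg _)

/-- The real function `f` stands in for `ψ`, whose domain `ℝ≥0` carries no derivative. -/
theorem IsGenerator.hasDerivAt_realInv (h : IsGenerator ψ) (hs : StrictAnti ψ) {f : ℝ → ℝ}
    (hf : ∀ z : ℝ≥0, f z = ψ z) {y f' : ℝ} (hy : y ∈ Ioo (0 : ℝ) 1)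
    (hd : HasDerivAt f f' (realInv ψ y)) (hf' : f' ≠ 0) : HasDerivAt (realInv ψ) f'⁻¹ y := by
  refine HasDerivAt.of_local_left_inverse (h.continuousAt_realInv hs hy) hd hf' ?_
  filter_upwards [Ioo_mem_nhds hy.1 hy.2] with x hx
  obtain ⟨z, hz, rfl⟩ := h.exists_pos_eq hx
  rw [h.realInv_apply hs, hf]

theorem archFun_eq_realInv (h : IsGenerator ψ) (hs : StrictAnti ψ) {f : ℝ → ℝ}
    (hf : ∀ z : ℝ≥0, f z = ψ z) {d : ℕ} {p : Fin d → ℝ} (hp : ∀ i, p i ∈ Ioo (0 : ℝ) 1) :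
    archFun ψ p = f (∑ i, realInv ψ (p i)) := by
  choose z _ hz using fun i => h.exists_pos_eq (hp i)
  obtain rfl : (fun i => ψ (z i)) = p := funext hz
  simp only [archFun_apply h hs, h.realInv_apply hs]
  rw [← NNReal.coe_sum, hf]

end

/-! ### Mixed partial derivatives -/

theorem sum_update_eq {d : ℕ} (f : ℝ → ℝ) (p : Fin d → ℝ) (i : Fin d) (t : ℝ) :
    ∑ j, f (Function.update p i t j) = f t + ∑ j ∈ Finset.univ.erase i, f (p j) := by
  rw [← Finset.add_sum_erase _ _ (Finset.mem_univ i), Function.update_self]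
  congr 1
  refine Finset.sum_congr rfl fun j hj => ?_
  rw [Function.update_of_ne (Finset.ne_of_mem_erase hj)]

/-- A mixed partial derivative of `F₀(∑ φ(pᵢ))` at an interior point, if it exists, is given by the
chain rule, where `F₀, …, F_m` are successive derivatives. -/
theorem HasMixedPartial.eq_chain {d m : ℕ} {C : (Fin d → ℝ) → ℝ} {F : ℕ → ℝ → ℝ} {φ φ' : ℝ → ℝ}
    (hC : ∀ p : Fin d → ℝ, (∀ i, p i ∈ Ioo (0 : ℝ) 1) → C p = F 0 (∑ i, φ (p i)))
    (hF : ∀ k < m, ∀ z, 0 < z → HasDerivAt (F k) (F (k + 1) z) z)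
    (hφ : 0 < m → ∀ y ∈ Ioo (0 : ℝ) 1, HasDerivAt φ (φ' y) y)
    (hpos : ∀ y ∈ Ioo (0 : ℝ) 1, 0 < φ y) {l : List (Fin d)} (hl : l.Nodup) (hlm : l.length ≤ m)
    {p : Fin d → ℝ} (hp : ∀ i, p i ∈ Ioo (0 : ℝ) 1) {v : ℝ} (hv : HasMixedPartial C l p v) :
    v = F l.length (∑ i, φ (p i)) * (l.map fun i => φ' (p i)).prod := by
  induction l generalizing p v with
  | nil =>
    rw [HasMixedPartial] at hv
    simp [← hv, hC p hp]
  | cons i l ih =>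
    obtain ⟨g, hg, hd⟩ := hv
    rw [List.nodup_cons] at hl
    have hm : l.length < m := by simpa using hlm
    have hI := Ioo_mem_nhds (hp i).1 (hp i).2
    have hnhds : Icc (0 : ℝ) 1 ∈ 𝓝 (p i) := mem_of_superset hI Ioo_subset_Icc_self
    rw [nhdsWithin_eq_nhds.2 hnhds] at hg
    set a := ∑ j ∈ Finset.univ.erase i, φ (p j)
    set c := (l.map fun i => φ' (p i)).prod with hc
    have hS : φ (p i) + a = ∑ j, φ (p j) :=
      Finset.add_sum_erase _ (fun j => φ (p j)) (Finset.mem_univ i)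
    have hSpos : 0 < φ (p i) + a :=
      add_pos_of_pos_of_nonneg (hpos _ (hp i)) (Finset.sum_nonneg fun j _ => (hpos _ (hp j)).le)
    -- Since `i` does not occur in `l`, the product of the `φ'` stays constant while coordinate `i`
    -- moves.
    have hge : g =ᶠ[𝓝 (p i)] fun t => F l.length (φ t + a) * c := by
      filter_upwards [hg, hI] with t ht htI
      have h1 := ih hl.2 hm.le (p := Function.update p i t) (fun j => ?_) ht
      · rw [h1, sum_update_eq, hc]
        congr 2
        refine List.map_congr_left fun j hj => ?_
        rw [Function.update_of_ne]
        rintro rfl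
        exact hl.1 hj
      · rcases eq_or_ne j i with rfl | hj
        · rwa [Function.update_self]
        · rw [Function.update_of_ne hj]; exact hp j
    have h2 : HasDerivAt g (F (l.length + 1) (φ (p i) + a) * φ' (p i) * c) (p i) :=
      (((hF _ hm _ hSpos).comp (p i)
        ((hφ (by omega) _ (hp i)).add_const a)).mul_const c).congr_of_eventuallyEq hge
    rw [(hd.hasDerivAt hnhds).unique h2, hS, List.length_cons, List.map_cons, List.prod_cons, ← hc,
      mul_assoc]

/-- If the mixed partial derivative exists for one more coordinate than the chain rule applies to,
then `t ↦ F_m(φ(t) + ∑_{j ≠ i} φ(pⱼ))` is differentiable. -/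
theorem MixedPartialExists.differentiableAt {d : ℕ} {C : (Fin d → ℝ) → ℝ} {F : ℕ → ℝ → ℝ}
    {φ φ' : ℝ → ℝ} {i : Fin d} {l : List (Fin d)}
    (hC : ∀ p : Fin d → ℝ, (∀ i, p i ∈ Ioo (0 : ℝ) 1) → C p = F 0 (∑ i, φ (p i)))
    (hF : ∀ k < l.length, ∀ z, 0 < z → HasDerivAt (F k) (F (k + 1) z) z)
    (hφ : 0 < l.length → ∀ y ∈ Ioo (0 : ℝ) 1, HasDerivAt φ (φ' y) y)
    (hφ' : 0 < l.length → ∀ y ∈ Ioo (0 : ℝ) 1, φ' y ≠ 0)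
    (hpos : ∀ y ∈ Ioo (0 : ℝ) 1, 0 < φ y) (hl : (i :: l).Nodup)
    {p : Fin d → ℝ} (hp : ∀ i, p i ∈ Ioo (0 : ℝ) 1) (hv : MixedPartialExists C (i :: l) p) :
    DifferentiableAt ℝ
      (fun t => F l.length (φ t + ∑ j ∈ Finset.univ.erase i, φ (p j))) (p i) := by
  obtain ⟨v, g, hg, hd⟩ := hv
  rw [List.nodup_cons] at hl
  have hI := Ioo_mem_nhds (hp i).1 (hp i).2
  have hnhds : Icc (0 : ℝ) 1 ∈ 𝓝 (p i) := mem_of_superset hI Ioo_subset_Icc_self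
  rw [nhdsWithin_eq_nhds.2 hnhds] at hg
  set a := ∑ j ∈ Finset.univ.erase i, φ (p j)
  set c := (l.map fun i => φ' (p i)).prod with hc
  have hc0 : c ≠ 0 := by
    refine List.prod_ne_zero fun h0 => ?_
    obtain ⟨j, hj, h0⟩ := List.mem_map.1 h0
    exact hφ' (List.length_pos_of_mem hj) _ (hp j) h0
  refine ((hd.hasDerivAt hnhds).differentiableAt.mul_const c⁻¹).congr_of_eventuallyEq ?_
  filter_upwards [hg, hI] with t ht htI
  have h1 := HasMixedPartial.eq_chain hC hF hφ hpos hl.2 le_rfl (p := Function.update p i t)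
    (fun j => ?_) ht
  · have h2 : (l.map fun j => φ' (Function.update p i t j)).prod = c := by
      rw [hc]
      congr 1
      refine List.map_congr_left fun j hj => ?_
      rw [Function.update_of_ne]
      rintro rfl
      exact hl.1 hj
    rw [h1, sum_update_eq, h2, mul_assoc, mul_inv_cancel₀ hc0, mul_one]
  · rcases eq_or_ne j i with rfl | hj
    · rwa [Function.update_self]
    · rw [Function.update_of_ne hj]; exact hp j

/-! ### The uniform law on the unit simplex -/

/-- The simplex of side `r` in `ℝ^n` with a vertex at the origin. -/
def cornerSimplex (n : ℕ) (r : ℝ) : Set (Fin n → ℝ) := {s | (∀ i, 0 ≤ s i) ∧ ∑ i, s i ≤ r}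

section

variable {n : ℕ}

theorem measurableSet_cornerSimplex (r : ℝ) : MeasurableSet (cornerSimplex n r) := by
  have h1 : IsClosed {s : Fin n → ℝ | ∀ i, 0 ≤ s i} := by
    simp only [ofPred_forall]
    exact isClosed_iInter fun i => isClosed_le continuous_const (continuous_apply i)
  have h2 : IsClosed {s : Fin n → ℝ | ∑ i, s i ≤ r} :=
    isClosed_le (by fun_prop) continuous_const
  exact (h1.inter h2).measurableSet

theorem volume_cornerSimplex_one_ne_top : volume (cornerSimplex n 1) ≠ ∞ := by
  refine ((measure_mono ?_).trans_lt
    (measure_Icc_lt_top (μ := (volume : Measure (Fin n → ℝ))) (a := 0) (b := 1))).ne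
  rintro s ⟨h0, h1⟩
  exact ⟨h0, fun i => (Finset.single_le_sum (fun j _ => h0 j) (Finset.mem_univ i)).trans h1⟩

theorem volume_cornerSimplex_one_ne_zero : volume (cornerSimplex n 1) ≠ 0 := by
  have hpos : 0 < volume (Set.univ.pi fun _ : Fin n => Ioo (0 : ℝ) (1 / (n + 1))) := by
    rw [Real.volume_pi_Ioo, pos_iff_ne_zero, Finset.prod_ne_zero_iff]
    intro _ _
    rw [ENNReal.ofReal_ne_zero_iff, sub_zero]
    positivity
  refine (hpos.trans_le (measure_mono (t := cornerSimplex n 1) fun s hs =>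
    ⟨fun i => (hs i trivial).1.le, ?_⟩)).ne'
  calc ∑ i, s i ≤ ∑ _ : Fin n, (1 / (n + 1) : ℝ) :=
        Finset.sum_le_sum fun i _ => (hs i trivial).2.le
    _ = n / (n + 1) := by simp; ring
    _ ≤ 1 := by rw [div_le_one (by positivity)]; linarith

open scoped Pointwise in
-- For `r > 0` this is the scaling of Lebesgue measure; for `r ≤ 0` the simplex is at most the
-- origin, which is null because `n ≥ 1`.
theorem volume_cornerSimplex (hn : 1 ≤ n) (r : ℝ) :
    volume (cornerSimplex n r) = ENNReal.ofReal (max r 0 ^ n) * volume (cornerSimplex n 1) := by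
  rcases le_or_gt r 0 with hr | hr
  · rw [max_eq_right hr, zero_pow (by omega), ENNReal.ofReal_zero, zero_mul]
    have : Nonempty (Fin n) := ⟨⟨0, hn⟩⟩
    refine measure_mono_null (t := {0}) (fun s hs => ?_) (measure_singleton _)
    have h1 : ∑ i, s i = 0 :=
      le_antisymm (hs.2.trans hr) (Finset.sum_nonneg fun i _ => hs.1 i)
    rw [Finset.sum_eq_zero_iff_of_nonneg fun i _ => hs.1 i] at h1
    exact funext fun i => h1 i (Finset.mem_univ i)
  · rw [max_eq_left hr.le]
    have h := Measure.addHaar_smul_of_nonneg (volume : Measure (Fin n → ℝ)) hr.le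
      (cornerSimplex n 1)
    rw [Module.finrank_fin_fun] at h
    rw [← h]
    congr 1
    ext s
    rw [mem_smul_set_iff_inv_smul_mem₀ hr.ne']
    simp only [cornerSimplex, mem_ofPred_eq, Pi.smul_apply, smul_eq_mul, ← Finset.mul_sum]
    rw [inv_mul_le_iff₀ hr, mul_one]
    simp [hr]

/-- The barycentric coordinates of a point of `cornerSimplex n 1`. -/
noncomputable def barycentric (s : Fin n → ℝ) : Fin (n + 1) → ℝ≥0 :=
  fun i => (Fin.snoc (α := fun _ => ℝ) s (1 - ∑ i, s i) i).toNNReal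

theorem measurable_barycentric : Measurable (barycentric (n := n)) := by
  rw [measurable_pi_iff]
  intro i
  induction i using Fin.lastCases with
  | last => simp only [barycentric, Fin.snoc_last]; fun_prop
  | cast i => simp only [barycentric, Fin.snoc_castSucc]; fun_prop

/-- The uniform law on the unit simplex of `ℝ^(n+1)`. -/
noncomputable def simplexLaw (n : ℕ) : Measure (Fin (n + 1) → ℝ≥0) :=
  (ProbabilityTheory.cond volume (cornerSimplex n 1)).map barycentric

instance : IsProbabilityMeasure (simplexLaw n) := by
  have := ProbabilityTheory.cond_isProbabilityMeasure_of_finite (μ := volume)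
    (volume_cornerSimplex_one_ne_zero (n := n)) volume_cornerSimplex_one_ne_top
  exact Measure.isProbabilityMeasure_map measurable_barycentric.aemeasurable

/-- The survival function of the uniform law on the unit simplex. -/
theorem simplexLaw_Ici (hn : 1 ≤ n) (x : Fin (n + 1) → ℝ≥0) :
    simplexLaw n (Ici x) = ENNReal.ofReal (max (1 - ∑ i, (x i : ℝ)) 0 ^ n) := by
  rw [simplexLaw, Measure.map_apply measurable_barycentric measurableSet_Ici,
    ProbabilityTheory.cond_apply (measurableSet_cornerSimplex 1)]
  -- Translating by the first `n` coordinates of `x` turns the constraints into those of a corner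
  -- simplex of side `1 - ∑ xᵢ`, possibly negative.
  have key : (fun s => (fun i : Fin n => (x i.castSucc : ℝ)) + s) ⁻¹'
      (cornerSimplex n 1 ∩ barycentric ⁻¹' Ici x) = cornerSimplex n (1 - ∑ i, (x i : ℝ)) := by
    ext s
    simp only [cornerSimplex, mem_preimage, mem_inter_iff, mem_ofPred_eq, mem_Ici, Pi.le_def,
      Pi.add_apply, Fin.forall_fin_succ', barycentric, Fin.snoc_last, Fin.snoc_castSucc,
      Finset.sum_add_distrib, Fin.sum_univ_castSucc]
    constructor
    · rintro ⟨⟨h1, h2⟩, h3, h4⟩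
      refine ⟨fun i => ?_, ?_⟩
      · have := NNReal.coe_le_coe.2 (h3 i)
        rw [Real.coe_toNNReal _ (h1 i)] at this
        linarith
      · have := NNReal.coe_le_coe.2 h4
        rw [Real.coe_toNNReal _ (by linarith)] at this
        linarith
    · rintro ⟨h1, h2⟩
      have h3 := (x (Fin.last n)).2
      refine ⟨⟨fun i => add_nonneg (x i.castSucc).2 (h1 i), by linarith⟩, fun i => ?_, ?_⟩
      · rw [← NNReal.coe_le_coe, Real.coe_toNNReal']
        exact le_max_of_le_left (by linarith [h1 i])
      · rw [← NNReal.coe_le_coe, Real.coe_toNNReal _ (by linarith)]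
        linarith
  rw [← measure_preimage_add volume (fun i : Fin n => (x i.castSucc : ℝ)) (_ ∩ _), key,
    volume_cornerSimplex hn (1 - _), mul_comm, mul_assoc,
    ENNReal.mul_inv_cancel volume_cornerSimplex_one_ne_zero volume_cornerSimplex_one_ne_top, mul_one]

end

/-! ### Archimedean copulas from Williamson transforms -/

section

variable {n : ℕ} {γ : Measure ℝ≥0}

/-- The law of `(ψ(S₁/T), …, ψ(S_d/T))` for `T ∼ γ` and `S` uniform on the unit simplex. -/
noncomputable def archLaw (n : ℕ) (γ : Measure ℝ≥0) : Measure (Fin (n + 1) → ℝ) :=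
  (γ.prod (simplexLaw n)).map fun q i => williamson (n + 1) γ (q.2 i / q.1)

theorem measurable_archLaw_map [IsFiniteMeasure γ] :
    Measurable fun (q : ℝ≥0 × (Fin (n + 1) → ℝ≥0)) (i : Fin (n + 1)) =>
      williamson (n + 1) γ (q.2 i / q.1) := by
  rw [measurable_pi_iff]
  intro i
  exact continuous_williamson.measurable.comp (by fun_prop)

instance [IsProbabilityMeasure γ] : IsProbabilityMeasure (archLaw n γ) :=
  Measure.isProbabilityMeasure_map measurable_archLaw_map.aemeasurable

/-- As `ψ` decreases, the event is `Sᵢ ≥ T zᵢ` for all `i`. Given `T = t` it has probability `(1 - t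
∑ zᵢ)₊^n`, and integration over `γ` gives `ψ(∑ zᵢ)`. -/
theorem archLaw_Iic_apply [IsProbabilityMeasure γ] (hn : 1 ≤ n) (h0 : γ {0} = 0)
    (hs : StrictAnti (williamson (n + 1) γ)) (z : Fin (n + 1) → ℝ≥0) :
    archLaw n γ (Iic fun i => williamson (n + 1) γ (z i)) =
      ENNReal.ofReal (williamson (n + 1) γ (∑ i, z i)) := by
  rw [archLaw, Measure.map_apply measurable_archLaw_map measurableSet_Iic,
    Measure.prod_apply (measurable_archLaw_map measurableSet_Iic), williamson,
    ofReal_integral_eq_lintegral_ofReal (integrable_williamson _)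
      (ae_of_all _ fun t => (williamson_integrand_mem_Icc _ t _).1)]
  have : ∀ᵐ t : ℝ≥0 ∂γ, t ≠ 0 := by
    rw [ae_iff]; simpa using h0
  refine lintegral_congr_ae ?_
  filter_upwards [this] with t ht
  have hset : Prod.mk t ⁻¹' ((fun (q : ℝ≥0 × (Fin (n + 1) → ℝ≥0)) (i : Fin (n + 1)) =>
      williamson (n + 1) γ (q.2 i / q.1)) ⁻¹' Iic fun i => williamson (n + 1) γ (z i)) =
      Ici fun i => t * z i := by
    ext s
    simp only [mem_preimage, mem_Iic, mem_Ici, Pi.le_def, hs.le_iff_ge]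
    refine forall_congr' fun i => ?_
    rw [le_div_iff₀ (pos_iff_ne_zero.2 ht), mul_comm]
  rw [hset, simplexLaw_Ici hn]
  simp [Finset.mul_sum]

theorem archLaw_Iic [IsProbabilityMeasure γ] (hn : 1 ≤ n) (h0 : γ {0} = 0)
    (hd : Dense {t : ℝ≥0 | γ {t} ≠ 0}) {x : Fin (n + 1) → ℝ} (hx : x ∈ Icc 0 1) :
    (archLaw n γ).real (Iic x) = archFun (williamson (n + 1) γ) x := by
  have hs := williamson_strictAnti hn hd
  have hg := isGenerator_williamson hn h0 hd
  by_cases h : ∃ i, x i = 0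
  · obtain ⟨i, hi⟩ := h
    rw [archFun_eq_zero hg hs hi, archLaw,
      map_measureReal_apply measurable_archLaw_map measurableSet_Iic]
    convert measureReal_empty
    refine eq_empty_of_forall_notMem fun q hq => ?_
    have h1 := hq i
    rw [hi] at h1
    exact absurd h1 (hg.pos hs _).not_ge
  · push Not at h
    choose z hz using fun i => hg.exists_eq ⟨(hx.1 i).lt_of_ne' (h i), hx.2 i⟩
    obtain rfl : (fun i => williamson (n + 1) γ (z i)) = x := funext hz
    rw [archFun_apply hg hs, measureReal_def, archLaw_Iic_apply hn h0 hs,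
      ENNReal.toReal_ofReal (hg.mem_Icc _).1]

theorem archLaw_map_eval [IsProbabilityMeasure γ] (hn : 1 ≤ n) (h0 : γ {0} = 0)
    (hd : Dense {t : ℝ≥0 | γ {t} ≠ 0}) (i : Fin (n + 1)) :
    (archLaw n γ).map (fun z => z i) = (volume : Measure ℝ).restrict (Icc 0 1) := by
  have hs := williamson_strictAnti hn hd
  have hg := isGenerator_williamson hn h0 hd
  have : IsProbabilityMeasure ((archLaw n γ).map fun z => z i) :=
    Measure.isProbabilityMeasure_map (measurable_pi_apply i).aemeasurable
  refine Measure.ext_of_Iic _ _ fun a => ?_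
  have hmap : (archLaw n γ).map (fun z => z i) (Iic a) =
      γ.prod (simplexLaw n) {q | williamson (n + 1) γ (q.2 i / q.1) ≤ a} := by
    rw [Measure.map_apply (by fun_prop) measurableSet_Iic, archLaw,
      Measure.map_apply measurable_archLaw_map (measurableSet_Iic.preimage (by fun_prop))]
    rfl
  have hvol : (volume : Measure ℝ).restrict (Icc 0 1) (Iic a) = ENNReal.ofReal (min a 1) := by
    rw [Measure.restrict_apply measurableSet_Iic, inter_comm, ← Ici_inter_Iic, inter_assoc,
      Iic_inter_Iic, Ici_inter_Iic, Real.volume_Icc,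
      sub_zero, inf_comm]
  rw [hvol]
  rcases le_or_gt a 0 with ha | ha
  · rw [hmap, ENNReal.ofReal_of_nonpos (min_le_of_left_le ha)]
    refine measure_mono_null (t := ∅) (subset_empty_iff.2 ?_) measure_empty
    exact eq_empty_of_forall_notMem fun q hq => absurd (le_trans hq ha) (hg.pos hs _).not_ge
  · obtain ⟨w, hw⟩ := hg.exists_eq ⟨lt_min ha one_pos, min_le_right a 1⟩
    -- The other coordinates get the bound `ψ(0) = 1`, which is no constraint.
    have h1 := archLaw_Iic_apply hn h0 hs (Pi.single i w)
    rw [Finset.sum_pi_single' , if_pos (Finset.mem_univ _), hw] at h1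
    rw [← h1, hmap, archLaw, Measure.map_apply measurable_archLaw_map measurableSet_Iic]
    congr 1
    ext q
    simp only [mem_ofPred_eq, mem_preimage, mem_Iic, Pi.le_def]
    constructor
    · intro hq j
      rcases eq_or_ne j i with rfl | hj
      · rw [Pi.single_eq_same, hw]
        exact le_min hq (hg.mem_Icc _).2
      · rw [Pi.single_eq_of_ne hj, hg.map_zero]
        exact (hg.mem_Icc _).2
    · intro hq
      have := hq i
      rw [Pi.single_eq_same, hw] at this
      exact this.trans (min_le_left _ _)

theorem isCopula_archFun_williamson [IsProbabilityMeasure γ] (hn : 1 ≤ n) (h0 : γ {0} = 0)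
    (hd : Dense {t : ℝ≥0 | γ {t} ≠ 0}) :
    IsCopula (archFun (williamson (n + 1) γ) : (Fin (n + 1) → ℝ) → ℝ) :=
  ⟨archLaw n γ, inferInstance, archLaw_map_eval hn h0 hd,
    fun _ hx => (archLaw_Iic hn h0 hd hx).symm⟩

end

/-! ### A discrete Williamson measure with dense atoms -/

theorem setIntegral_Iic_one_eq_williamson {n : ℕ} (hn : 1 ≤ n) (γ : Measure ℝ≥0) :
    ∫ t in Iic (1 : ℝ≥0), (1 - (t : ℝ)) ^ n ∂γ = williamson (n + 1) γ 1 := by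
  rw [← integral_indicator measurableSet_Iic, williamson]
  congr 1 with t
  simp only [indicator, mem_Iic, NNReal.coe_one, mul_one, Nat.add_sub_cancel]
  split_ifs with h
  · rw [max_eq_left (sub_nonneg.2 (by exact_mod_cast h))]
  · have h1 : (1 : ℝ) < t := by exact_mod_cast not_le.1 h
    rw [max_eq_right (by linarith), zero_pow (by omega)]

/-- A discrete probability measure on `(0, ∞)` whose atoms are dense. -/
theorem exists_isDiscrete_dense_atoms :
    ∃ γ : Measure ℝ≥0, IsProbabilityMeasure γ ∧ γ {0} = 0 ∧ IsDiscrete γ ∧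
      Dense {t : ℝ≥0 | γ {t} ≠ 0} := by
  -- Avoiding the bottom element `0` ensures that `γ` has no mass there.
  obtain ⟨s, hsc, hsd, hs0, -⟩ := exists_countable_dense_no_bot_top ℝ≥0
  obtain ⟨q, rfl⟩ := hsc.exists_eq_range hsd.nonempty
  let γ : Measure ℝ≥0 := Measure.sum fun k : ℕ => (2⁻¹ : ℝ≥0∞) ^ (k + 1) • Measure.dirac (q k)
  have hγ : ∀ A, MeasurableSet A → γ A = ∑' k, (2⁻¹ : ℝ≥0∞) ^ (k + 1) * A.indicator 1 (q k) := by
    intro A hA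
    simp [γ, Measure.sum_apply _ hA, Measure.dirac_apply' _ hA]
  have hnull : ∀ A, MeasurableSet A → Disjoint A (range q) → γ A = 0 := by
    intro A hA h
    rw [hγ A hA, ENNReal.tsum_eq_zero]
    intro k
    rw [indicator_of_notMem (disjoint_right.1 h (mem_range_self k)), mul_zero]
  refine ⟨γ, ⟨?_⟩, ?_, ⟨range q, hsc, ?_⟩, hsd.mono ?_⟩
  · rw [hγ _ MeasurableSet.univ]
    simp only [indicator_univ, Pi.one_apply, mul_one]
    rw [ENNReal.tsum_geometric_add_one, ENNReal.one_sub_inv_two, inv_inv]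
    exact ENNReal.inv_mul_cancel (by simp) (by simp)
  · refine hnull _ (measurableSet_singleton 0) (disjoint_singleton_left.2 (hs0 0 ?_))
    exact fun x => zero_le
  · exact hnull _ hsc.measurableSet.compl disjoint_compl_left
  · rintro _ ⟨k, rfl⟩ h
    rw [hγ _ (measurableSet_singleton _), ENNReal.tsum_eq_zero] at h
    simpa using h k

/-- Mixing in a point mass keeps the atoms dense. With `a = ψ(1)` for the original measure and `s`
solving `(1 - s)^n = 1 - a`, the equal mixture has normalizing integral `(a + (1 - a)) / 2 = 1/2`.
-/
theorem exists_isWilliamsonMeasure {n : ℕ} (hn : 1 ≤ n) :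
    ∃ γ : Measure ℝ≥0, IsWilliamsonMeasure (n + 1) γ ∧ IsDiscrete γ ∧
      Dense {t : ℝ≥0 | γ {t} ≠ 0} := by
  obtain ⟨γ, hγ, h0, ⟨S, hSc, hS⟩, hd⟩ := exists_isDiscrete_dense_atoms
  have ha1 := (williamson_mem_Icc (n := n) (γ := γ) 1).2
  have ha0 : 0 < williamson (n + 1) γ 1 :=
    (isGenerator_williamson hn h0 hd).pos (williamson_strictAnti hn hd) 1
  set a := williamson (n + 1) γ 1 with ha
  set r : ℝ := (1 - a) ^ (n⁻¹ : ℝ) with hr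
  have hrn : r ^ n = 1 - a := Real.rpow_inv_natCast_pow (by linarith) (by omega)
  have hr0 : 0 ≤ r := Real.rpow_nonneg (by linarith) _
  have hr1 : r < 1 := by
    by_contra! h
    linarith [one_le_pow₀ h (n := n)]
  set s : ℝ≥0 := ⟨1 - r, by linarith⟩ with hs
  have hs0 : s ≠ 0 := by
    intro h
    have : 1 - r = 0 := congrArg NNReal.toReal h
    linarith
  let γ' : Measure ℝ≥0 := (2⁻¹ : ℝ≥0∞) • γ + (2⁻¹ : ℝ≥0∞) • Measure.dirac s
  have happly : ∀ A, γ' A = 2⁻¹ * γ A + 2⁻¹ * Measure.dirac s A := fun A => by simp [γ']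
  refine ⟨γ', ⟨⟨?_⟩, ?_, ?_⟩, ⟨S ∪ {s}, hSc.union (countable_singleton s), ?_⟩, hd.mono ?_⟩
  · rw [happly, measure_univ, measure_univ, mul_one, ENNReal.inv_two_add_inv_two]
  · rw [happly, h0, Measure.dirac_apply' _ (measurableSet_singleton 0)]
    simp [hs0]
  · rw [Nat.add_sub_cancel, setIntegral_Iic_one_eq_williamson hn, williamson,
      integral_add_measure ((integrable_williamson 1).smul_measure (by simp))
        ((integrable_williamson 1).smul_measure (by simp)), integral_smul_measure,
      integral_smul_measure, integral_dirac, ← williamson, ← ha, Nat.add_sub_cancel]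
    have : max (1 - (s : ℝ) * ((1 : ℝ≥0) : ℝ)) 0 ^ n = 1 - a := by
      rw [← hrn, NNReal.coe_one, mul_one, show (s : ℝ) = 1 - r from rfl, sub_sub_cancel,
        max_eq_left hr0]
    rw [this, ENNReal.toReal_inv, ENNReal.toReal_ofNat, smul_eq_mul, smul_eq_mul]
    ring
  · rw [happly, measure_mono_null (compl_subset_compl.2 subset_union_left) hS,
      Measure.dirac_apply' _ (hSc.union (countable_singleton s)).measurableSet.compl]
    simp
  · intro t ht h
    rw [happly, add_eq_zero] at h
    simp only [mul_eq_zero, ENNReal.inv_eq_zero, ENNReal.ofNat_ne_top, false_or] at h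
    exact ht h.1

/-! ### Non-differentiability -/

section

variable {n : ℕ} {γ : Measure ℝ≥0}

/-- The assumption `hdiff` serves to undo the inner `φ` in the coordinate differentiated last. It is
a real restriction only for `n = 1`; in that case no derivative of `φ` enters. -/
theorem not_mixedPartialExists_of_atom [IsProbabilityMeasure γ] (hn : 1 ≤ n) (h0 : γ {0} = 0)
    (hd : Dense {t : ℝ≥0 | γ {t} ≠ 0}) {l : List (Fin (n + 1))} (hl : l.Nodup)
    (hlen : l.length = n) {p : Fin (n + 1) → ℝ} (hp : ∀ i, p i ∈ Ioo (0 : ℝ) 1)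
    (hdiff : ∀ i ∈ l,
      DifferentiableAt ℝ (truncMoment γ 0 n) (realInv (williamson (n + 1) γ) (p i)))
    {t₀ : ℝ≥0} (ht₀ : γ {t₀} ≠ 0)
    (hsum : (t₀ : ℝ) * ∑ i, realInv (williamson (n + 1) γ) (p i) = 1) :
    ¬ MixedPartialExists (archFun (williamson (n + 1) γ)) l p := by
  intro hex
  have hs := williamson_strictAnti hn hd
  have hg := isGenerator_williamson hn h0 hd
  set φ := realInv (williamson (n + 1) γ) with hφ
  have hf : ∀ z : ℝ≥0, truncMoment γ 0 n z = williamson (n + 1) γ z := fun z =>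
    (williamson_eq_truncMoment z).symm
  obtain _ | ⟨i, l⟩ := l
  · simp only [List.length_nil] at hlen; omega
  obtain ⟨m, rfl⟩ : ∃ m, n = m + 1 := ⟨l.length, hlen.symm⟩
  have hlen : l.length = m := by simpa using hlen
  have hder : 0 < m → ∀ y ∈ Ioo (0 : ℝ) 1,
      HasDerivAt (truncMoment γ 0 (m + 1)) (-(m + 1) * truncMoment γ 1 m (φ y)) (φ y) ∧
        -(m + 1) * truncMoment γ 1 m (φ y) ≠ 0 := by
    intro hm y hy
    have hpos := hg.realInv_pos hs hy
    obtain ⟨t, h1, h2, h3⟩ := exists_small_atom hd hpos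
    refine ⟨hasDerivAt_truncMoment hm hpos, ?_⟩
    have h4 := truncMoment_pos (j := 1) hm hpos h1 h2 h3
    have h5 : (0 : ℝ) < m + 1 := by positivity
    exact (mul_neg_of_neg_of_pos (neg_lt_zero.2 h5) h4).ne
  -- The `k`-th derivative of `ψ` is `(-1)^k n(n-1)⋯(n-k+1) ∫ t^k (1 - tz)₊^(n-k) dγ(t)`, here with
  -- `n = m + 1`.
  have hF : ∀ k < l.length, ∀ z, 0 < z → HasDerivAt
      (fun z => (-1) ^ k * ((m + 1).descFactorial k : ℝ) * truncMoment γ k (m + 1 - k) z)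
      ((-1) ^ (k + 1) * ((m + 1).descFactorial (k + 1) : ℝ) *
        truncMoment γ (k + 1) (m + 1 - (k + 1)) z) z := by
    intro k hk z hz
    have h1 := (hasDerivAt_truncMoment (γ := γ) (j := k) (m := m - k) (by omega) hz).const_mul
      ((-1 : ℝ) ^ k * ((m + 1).descFactorial k : ℝ))
    rw [show m + 1 - k = m - k + 1 by omega, show m + 1 - (k + 1) = m - k by omega]
    refine h1.congr_deriv ?_
    rw [Nat.descFactorial_succ, show m + 1 - k = m - k + 1 by omega]
    push_cast
    ring
  have key := MixedPartialExists.differentiableAt (C := archFun (williamson (m + 1 + 1) γ))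
    (F := fun k z => (-1) ^ k * ((m + 1).descFactorial k : ℝ) * truncMoment γ k (m + 1 - k) z)
    (φ := φ) (φ' := fun y => (-(m + 1) * truncMoment γ 1 m (φ y))⁻¹) (l := l) (i := i) (p := p)
    (fun p hp => by simpa using archFun_eq_realInv hg hs hf hp) hF
    (fun hm y hy => hg.hasDerivAt_realInv hs hf hy (hder (hlen ▸ hm) y hy).1
      (hder (hlen ▸ hm) y hy).2)
    (fun hm y hy => inv_ne_zero (hder (hlen ▸ hm) y hy).2) (fun y hy => hg.realInv_pos hs hy) hl hp
    hex
  rw [hlen] at key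
  have hc : (-1 : ℝ) ^ m * ((m + 1).descFactorial m : ℝ) ≠ 0 := by
    refine mul_ne_zero (pow_ne_zero _ (by norm_num)) (Nat.cast_ne_zero.2 ?_)
    rw [Ne, Nat.descFactorial_eq_zero_iff_lt]
    omega
  have hi := hdiff i (List.mem_cons_self ..)
  have hpi := hg.realInv_pos hs (hp i)
  set a := ∑ j ∈ Finset.univ.erase i, φ (p j)
  have hS : φ (p i) + a = ∑ j, φ (p j) :=
    Finset.add_sum_erase _ (fun j => φ (p j)) (Finset.mem_univ i)
  have hval : ∀ z, 0 ≤ z → φ (truncMoment γ 0 (m + 1) z) = z := by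
    intro z hz
    lift z to ℝ≥0 using hz
    rw [hf, hφ, hg.realInv_apply hs]
  have hpval : truncMoment γ 0 (m + 1) (φ (p i)) = p i := by
    obtain ⟨z, -, hz⟩ := hg.exists_pos_eq (hp i)
    rw [← hz, hφ, hg.realInv_apply hs, hf]
  have h1 := (key.const_mul ((-1 : ℝ) ^ m * ((m + 1).descFactorial m : ℝ))⁻¹)
  -- Writing `p i` as `ψ(φ(p i))` lets `h1` be composed with `ψ`.
  rw [← hpval] at h1
  have h2 := h1.comp (φ (p i)) hi
  have h3 : DifferentiableAt ℝ (fun z => truncMoment γ m 1 (z + a)) (φ (p i)) := by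
    refine h2.congr_of_eventuallyEq ?_
    filter_upwards [eventually_gt_nhds hpi] with z hz
    rw [Function.comp_apply, hval z hz.le, ← mul_assoc, inv_mul_cancel₀ hc, one_mul,
      Nat.add_sub_cancel_left]
  rw [differentiableAt_comp_add_const, hS] at h3
  refine not_differentiableAt_truncMoment ht₀ ?_ hsum h3
  by_contra! h
  nlinarith [t₀.2, mul_nonpos_of_nonneg_of_nonpos t₀.2 h]

/-- The levels `ψ(φ(x₁) + ⋯ + φ(x_n) + w)` hitting an atom are dense. -/
theorem Icc_subset_closure_of_atoms [IsProbabilityMeasure γ] (hn : 1 ≤ n) (h0 : γ {0} = 0)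
    (hd : Dense {t : ℝ≥0 | γ {t} ≠ 0}) (a : ℝ≥0) :
    Icc (0 : ℝ) 1 ⊆ closure (williamson (n + 1) γ ''
      {w | 0 < w ∧ ∃ t, γ {t} ≠ 0 ∧ t * (a + w) = 1}) := by
  have hg := isGenerator_williamson hn h0 hd
  rw [← closure_Ioo zero_ne_one]
  refine closure_minimal (fun y hy => ?_) isClosed_closure
  obtain ⟨z, hz, rfl⟩ := hg.exists_pos_eq hy
  have haz : a + z ≠ 0 := (add_pos_of_nonneg_of_pos zero_le hz).ne'
  have hinv : ContinuousAt (fun t : ℝ≥0 => t⁻¹) (a + z)⁻¹ :=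
    continuousAt_inv₀ (inv_ne_zero haz)
  -- An atom `t` near `1/(a + z)` yields `w = 1/t - a` with `ψ(w)` near `ψ(z)`. The subtraction is
  -- truncated, so `a < 1/t` is secured separately in `hlt`.
  have hcont : ContinuousAt (fun t : ℝ≥0 => williamson (n + 1) γ (t⁻¹ - a)) (a + z)⁻¹ :=
    continuous_williamson.continuousAt.comp (hinv.sub continuousAt_const)
  rw [mem_closure_iff_nhds]
  intro U hU
  have hU' : ∀ᶠ t in 𝓝 (a + z)⁻¹, williamson (n + 1) γ (t⁻¹ - a) ∈ U := by
    refine hcont.eventually ?_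
    beta_reduce
    rwa [inv_inv, add_tsub_cancel_left]
  have hlt : ∀ᶠ t in 𝓝 (a + z)⁻¹, a < t⁻¹ := by
    refine hinv.eventually (lt_mem_nhds ?_)
    beta_reduce
    rw [inv_inv]
    exact lt_add_of_pos_right a hz
  obtain ⟨t, ⟨h1, h2⟩, h3⟩ := mem_closure_iff_nhds.1 (hd (a + z)⁻¹) _ (hU'.and hlt)
  refine ⟨_, h1, _, ⟨tsub_pos_of_lt h2, t, h3, ?_⟩, rfl⟩
  rw [add_tsub_cancel_of_le h2.le, mul_inv_cancel₀]
  rintro rfl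
  exact h3 h0

theorem ordering_nodup (σ : Equiv.Perm (Fin n)) : (ordering σ).Nodup :=
  List.nodup_ofFn.2 ((Fin.castSucc_injective n).comp σ.injective)

end

end ArchCop

open ArchCop in
/-- The dimension is `d = n + 1 ≥ 2`. The identity permutation `σ` gives `∂₁ ⋯ ∂_{d-1} C(x, y)`. -/
theorem theorem5p2 (n : ℕ) (hn : 1 ≤ n) :
    ∃ C : (Fin (n + 1) → ℝ) → ℝ, ArchCop.IsArchimedeanCopula C ∧
      (∃ γ : Measure ℝ≥0, ArchCop.IsWilliamsonMeasure (n + 1) γ ∧ ArchCop.IsDiscrete γ ∧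
        Dense {t : ℝ≥0 | γ {t} ≠ 0} ∧
        ArchCop.IsGenerator (ArchCop.williamson (n + 1) γ) ∧
        ∀ x ∈ Icc (0 : Fin (n + 1) → ℝ) 1,
          C x = ArchCop.archFun (ArchCop.williamson (n + 1) γ) x) ∧
      ∃ Λ : Set (Fin n → ℝ), MeasurableSet Λ ∧ Λ ⊆ Icc 0 1 ∧ volume Λ = 1 ∧
        ∀ x ∈ Λ, ∀ σ : Equiv.Perm (Fin n),
          Icc (0 : ℝ) 1 ⊆ closure {y : ℝ | y ∈ Icc (0 : ℝ) 1 ∧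
            ¬ ArchCop.MixedPartialExists C (ArchCop.ordering σ) (ArchCop.point x y)} := by
  obtain ⟨γ, hW, hD, hd⟩ := exists_isWilliamsonMeasure hn
  have := hW.isProbabilityMeasure
  have h0 := hW.no_mass_zero
  have hs := williamson_strictAnti hn hd
  have hg := isGenerator_williamson hn h0 hd
  set ψ := williamson (n + 1) γ with hψ
  refine ⟨archFun ψ, ⟨isCopula_archFun_williamson hn h0 hd, ψ, hg, fun _ _ => rfl⟩,
    ⟨γ, hW, hD, hd, hg, fun _ _ => rfl⟩, ?_⟩
  obtain ⟨S, hSc, hS⟩ := hD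
  -- `K` collects the values `ψ(1/t)` for `t ∈ S`. Off it, `1/φ(xᵢ)` is not in `S`, so `ψ` is
  -- differentiable at `φ(xᵢ)` even when `n = 1`.
  set K : Set ℝ := ψ '' ((fun z : ℝ≥0 => z⁻¹) ⁻¹' S) with hK
  have hKc : K.Countable := (hSc.preimage inv_injective).image ψ
  have hGm : MeasurableSet (Ioo (0 : ℝ) 1 \ K) := measurableSet_Ioo.diff hKc.measurableSet
  have hGv : volume (Ioo (0 : ℝ) 1 \ K) = 1 := by
    rw [measure_sdiff_null (hKc.measure_zero _)]
    simp
  refine ⟨Set.univ.pi fun _ => Ioo (0 : ℝ) 1 \ K, MeasurableSet.univ_pi fun _ => hGm,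
    fun x hx => ⟨fun i => (hx i trivial).1.1.le, fun i => (hx i trivial).1.2.le⟩, ?_, ?_⟩
  · rw [volume_pi, Measure.pi_pi]
    simp [hGv]
  · intro x hx σ
    choose z hzpos hz using fun i => hg.exists_pos_eq (hx i trivial).1
    obtain rfl : (fun i => ψ (z i)) = x := funext hz
    refine (Icc_subset_closure_of_atoms hn h0 hd (∑ i, z i)).trans (closure_mono ?_)
    rintro _ ⟨w, ⟨hw, t, ht, htw⟩, rfl⟩
    have hmem := hg.apply_mem_Ioo hs hw
    refine ⟨Ioo_subset_Icc_self hmem, not_mixedPartialExists_of_atom hn h0 hd (ordering_nodup σ)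
      (by simp [ordering]) ?_ ?_ ht ?_⟩
    · intro i
      induction i using Fin.lastCases with
      | last => simpa [point] using hmem
      | cast i => simpa [point] using hg.apply_mem_Ioo hs (hzpos i)
    · intro i hi
      obtain ⟨k, rfl⟩ := List.mem_ofFn.1 hi
      rw [point, Fin.snoc_castSucc, hg.realInv_apply hs]
      refine differentiableAt_truncMoment hn (hzpos _) (Or.inr ?_)
      have hnot : (z (σ k))⁻¹ ∉ S := fun h => (hx (σ k) trivial).2 ⟨_, h, rfl⟩
      have hae : ∀ᵐ t ∂γ, t ∈ S := hS
      filter_upwards [hae] with t htS h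
      refine hnot ?_
      have h1 : t * z (σ k) = 1 := by exact_mod_cast h
      rwa [← eq_inv_of_mul_eq_one_left h1]
    · simp only [Fin.sum_univ_castSucc, point, Fin.snoc_castSucc, Fin.snoc_last, ← hψ,
        hg.realInv_apply hs]
      exact_mod_cast htw
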